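/- Let $\mathbb{T}^2$ be the two-dimensional torus with normalised Lebesgue measure, and let $f:\mathbb{T}^2\to\mathbb{R}$ be a strictly positive, essentially bounded, lower semicontinuous function. Let $e_1,e_2\in\mathbb{R}^2$ be linearly independent and let $C^+=\{a e_1+b e_2 : a,b\ge 0\}$ be the half-cone with vertex $O=(0,0)$ that they span (so $C^+$ is one of the two half-cones of the cone $C=C^+\cup(-C^+)$). Put $$H^{C^+}=\{\psi\in L^\infty(\mathbb{T}^2) : \hat\psi(k)=0 \text{ for all } k\in\mathbb{Z}^2\setminus C^+\}.$$ Then there exists $\alpha\in H^{C^+}$ such that $f=\alpha\bar\alpha$ almost everywhere on $\mathbb{T}^2$. -/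

import Mathlib

open MeasureTheory
open scoped ENNReal ComplexConjugate

/-- The torus `𝕋²`, in the model `(ℝ / ℤ)²`: the class of `(x₁, x₂)` stands for the point
`(exp (2πi x₁), exp (2πi x₂))`. -/
abbrev Torus2 : Type := UnitAddTorus (Fin 2)

/-- Lebesgue (Haar) measure on the torus `𝕋²`, of total mass one. -/
noncomputable def torusMeasure : Measure Torus2 :=
  Measure.pi fun _ => AddCircle.haarAddCircle

/-- Mathlib's multivariate Fourier coefficient is the integral against `torusMeasure`. -/
theorem mFourierCoeff_eq_integral_torusMeasure (ψ : Torus2 → ℂ) (k : Fin 2 → ℤ) :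
    UnitAddTorus.mFourierCoeff ψ k
      = ∫ t, UnitAddTorus.mFourier (-k) t * ψ t ∂torusMeasure := rfl

/-- The half-cone `C⁺[e₁, e₂] = {a e₁ + b e₂ : a, b ≥ 0}` with vertex the origin. -/
def halfCone (e₁ e₂ : Fin 2 → ℝ) : Set (Fin 2 → ℝ) :=
  {v | ∃ a b : ℝ, 0 ≤ a ∧ 0 ≤ b ∧ v = a • e₁ + b • e₂}

/-- `K` is one of the two half-cones `C⁺`, `-C⁺` of a cone `C = C⁺ ∪ (-C⁺)` of the plane with vertex
the origin, not reduced to a line. The other half-cone is spanned by `-e₁`, `-e₂`, so both are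
covered. -/
def IsHalfCone (K : Set (Fin 2 → ℝ)) : Prop :=
  ∃ e₁ e₂ : Fin 2 → ℝ, LinearIndependent ℝ ![e₁, e₂] ∧ K = halfCone e₁ e₂

/-- The Fourier spectrum of a function on `𝕋²`. -/
def fourierSpectrum (ψ : Torus2 → ℂ) : Set (Fin 2 → ℤ) :=
  {k | UnitAddTorus.mFourierCoeff ψ k ≠ 0}

/-- `H^K`: the functions in `L^∞(𝕋²)` whose Fourier coefficients vanish outside `K`. -/
def hardySpace (K : Set (Fin 2 → ℝ)) : Set (Torus2 → ℂ) :=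
  {ψ | MemLp ψ ∞ torusMeasure ∧ ∀ k ∈ fourierSpectrum ψ, (fun i => (k i : ℝ)) ∈ K}

open UnitAddTorus Filter Topology

/-! The half-cone is the set where two linear functionals are nonnegative, and `hardyGE φ c` grades
bounded functions by a lower bound on both over the spectrum. Levels add under products, and
trigonometric polynomials have finite, possibly negative, level.

Let `p ≥ 0` be a real trigonometric polynomial and `ζ` a character deep in the cone. Every `p ζ ^ m`
with `m ≥ 1` has spectrum in the cone, hence so does `exp (-p ζ / (1 - ζ))`. Its modulus is `exp (p
/ 2)` almost everywhere, because `ζ / (1 - ζ)` has real part `-1/2` on the unit circle.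

Write `f` as an increasing limit of `exp (q n)`, with `q n` real trigonometric polynomials.
Multiplying by such a block turns `A` with `|A|² = exp q` into `B` with `|B|² = exp q'`. As `ζ` goes
deeper, the block minus `1` becomes nearly orthogonal to `exp q`, so `‖B - A‖₂²` is at most `∫ exp
q' - ∫ exp q` plus an arbitrarily small error (`exists_hardyGE_raise`). These increments are
controlled by `∫ f`, so a sparse subsequence is Cauchy in `L²` and its limit is `α`
(`exists_hardyGE_limit`). -/

instance : IsProbabilityMeasure torusMeasure := by
  unfold torusMeasure; infer_instance

/-! ### Fourier coefficients of products -/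

theorem MeasureTheory.MemLp.mul_of_top {f g : Torus2 → ℂ} (hf : MemLp f ∞ torusMeasure)
    (hg : MemLp g ∞ torusMeasure) : MemLp (fun t => f t * g t) ∞ torusMeasure :=
  hg.mul hf

theorem ContinuousMap.memLp_torusMeasure (f : C(Torus2, ℂ)) (p : ℝ≥0∞) :
    MemLp f p torusMeasure :=
  (MemLp.of_bound f.continuous.aestronglyMeasurable ‖f‖
    (ae_of_all _ f.norm_coe_le_norm) : MemLp f ∞ torusMeasure).mono_exponent le_top

theorem memLp_conj_torusMeasure {f : Torus2 → ℂ} {p : ℝ≥0∞} (hf : MemLp f p torusMeasure) :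
    MemLp (fun t => conj (f t)) p torusMeasure :=
  hf.star

/-- Parseval's identity for a product of bounded functions: the Fourier coefficients of a product
are the convolution of the Fourier coefficients. -/
theorem hasSum_mFourierCoeff_mul {f g : Torus2 → ℂ} (hf : MemLp f ∞ torusMeasure)
    (hg : MemLp g ∞ torusMeasure) (k : Fin 2 → ℤ) :
    HasSum (fun j => mFourierCoeff f (k - j) * mFourierCoeff g j)
      (mFourierCoeff (fun t => f t * g t) k) := by
  -- The conjugation cancels the one in the `L²` pairing, which then computes the coefficient of `f
  -- g` at `k`.
  have hF : MemLp (fun t => conj (mFourier (-k) t * f t)) 2 torusMeasure :=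
    memLp_conj_torusMeasure
      ((((mFourier (-k)).memLp_torusMeasure ∞).mul_of_top hf).mono_exponent le_top)
  have hG : MemLp g 2 torusMeasure := hg.mono_exponent le_top
  have key : HasSum (fun i => conj (mFourierCoeff (hF.toLp _) i) * mFourierCoeff (hG.toLp _) i)
      (∫ t, conj (hF.toLp _ t) * hG.toLp _ t ∂torusMeasure) :=
    hasSum_prod_mFourierCoeff (hF.toLp _) (hG.toLp _)
  have e1 : ∀ j, conj (mFourierCoeff (hF.toLp _) j) = mFourierCoeff f (k - j) := by
    intro j
    rw [mFourierCoeff_eq_integral_torusMeasure, mFourierCoeff_eq_integral_torusMeasure,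
      ← integral_conj]
    refine integral_congr_ae ?_
    filter_upwards [hF.coeFn_toLp] with t ht
    rw [ht]
    simp only [map_mul, mFourier_neg, Complex.conj_conj, sub_eq_add_neg, neg_add, mFourier_add]
    ring
  have e2 : ∀ j, mFourierCoeff (hG.toLp _) j = mFourierCoeff g j := by
    intro j
    refine integral_congr_ae ?_
    filter_upwards [hG.coeFn_toLp] with t ht
    rw [ht]
  simp only [e1, e2] at key
  convert! key using 1
  refine integral_congr_ae ?_
  filter_upwards [hG.coeFn_toLp, hF.coeFn_toLp] with t ht ht'
  rw [ht, ht', smul_eq_mul, Complex.conj_conj, mul_assoc]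

theorem integrable_mFourier_mul {f : Torus2 → ℂ} (hf : MemLp f ∞ torusMeasure) (k : Fin 2 → ℤ) :
    Integrable (fun t => mFourier k t * f t) torusMeasure :=
  memLp_one_iff_integrable.1
    ((((mFourier k).memLp_torusMeasure ∞).mul_of_top hf).mono_exponent le_top)

/-! ### Bounded functions graded by spectral level -/

/-- The bounded functions on the torus whose Fourier spectrum lies in the set where the two
additive functionals `φ 0`, `φ 1` are at least `c`. -/
def hardyGE (φ : Fin 2 → (Fin 2 → ℤ) →+ ℝ) (c : ℝ) : Submodule ℂ (Torus2 → ℂ) where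
  carrier := {g | MemLp g ∞ torusMeasure ∧ ∀ k, mFourierCoeff g k ≠ 0 → ∀ i, c ≤ φ i k}
  zero_mem' := by
    refine ⟨MemLp.zero, fun k hk => absurd ?_ hk⟩
    simp [mFourierCoeff]
  add_mem' := by
    rintro f g ⟨hf, hf'⟩ ⟨hg, hg'⟩
    refine ⟨hf.add hg, fun k hk => ?_⟩
    by_cases h1 : mFourierCoeff f k = 0
    · refine hg' k fun h2 => hk ?_
      rw [mFourierCoeff_eq_integral_torusMeasure] at h1 h2 ⊢
      simp only [Pi.add_apply, mul_add]
      rw [integral_add (integrable_mFourier_mul hf _) (integrable_mFourier_mul hg _), h1, h2,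
        add_zero]
    · exact hf' k h1
  smul_mem' := by
    rintro z f ⟨hf, hf'⟩
    refine ⟨hf.const_smul z, fun k hk => hf' k fun h => hk ?_⟩
    rw [mFourierCoeff_eq_integral_torusMeasure] at h ⊢
    simp only [Pi.smul_apply, smul_eq_mul, mul_left_comm _ z]
    rw [integral_const_mul, h, mul_zero]

section

variable {φ : Fin 2 → (Fin 2 → ℤ) →+ ℝ} {c c' : ℝ} {f g : Torus2 → ℂ}

theorem hardyGE_mono (h : c ≤ c') (hf : f ∈ hardyGE φ c') : f ∈ hardyGE φ c :=
  ⟨hf.1, fun k hk i => h.trans (hf.2 k hk i)⟩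

/-- A nonzero coefficient of the product forces a nonzero term in the convolution, and the
functionals are additive. -/
theorem mul_mem_hardyGE (hf : f ∈ hardyGE φ c) (hg : g ∈ hardyGE φ c') :
    (fun t => f t * g t) ∈ hardyGE φ (c + c') := by
  refine ⟨hf.1.mul_of_top hg.1, fun k hk => ?_⟩
  have hs := hasSum_mFourierCoeff_mul hf.1 hg.1 k
  obtain ⟨j, hj⟩ : ∃ j, mFourierCoeff f (k - j) * mFourierCoeff g j ≠ 0 := by
    by_contra! h
    exact hk (hs.unique (by simpa only [h] using hasSum_zero))
  intro i
  have h1 := hf.2 _ (left_ne_zero_of_mul hj) i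
  have h2 := hg.2 _ (right_ne_zero_of_mul hj) i
  rw [map_sub] at h1
  linarith

/-- Bounded almost everywhere limits preserve the spectral condition. -/
theorem hardyGE_of_tendsto {F : ℕ → Torus2 → ℂ} (hF : ∀ n, F n ∈ hardyGE φ c) (C : ℝ)
    (hC : ∀ n, ∀ᵐ t ∂torusMeasure, ‖F n t‖ ≤ C)
    (hlim : ∀ᵐ t ∂torusMeasure, Tendsto (fun n => F n t) atTop (𝓝 (f t))) : f ∈ hardyGE φ c := by
  have hm : AEStronglyMeasurable f torusMeasure :=
    aestronglyMeasurable_of_tendsto_ae atTop (fun n => (hF n).1.1) hlim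
  have hb : ∀ᵐ t ∂torusMeasure, ‖f t‖ ≤ C := by
    filter_upwards [hlim, ae_all_iff.2 hC] with t h1 h2
    exact le_of_tendsto' h1.norm h2
  refine ⟨MemLp.of_bound hm C hb, fun k hk i => ?_⟩
  by_contra hlt
  have hz : ∀ n, mFourierCoeff (F n) k = 0 := fun n => by
    by_contra h0
    exact hlt ((hF n).2 k h0 i)
  refine hk (tendsto_nhds_unique (f := fun n => mFourierCoeff (F n) k) (l := atTop) ?_
    (by simpa only [hz] using tendsto_const_nhds))
  refine tendsto_integral_of_dominated_convergence (fun _ => C)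
    (fun n => (integrable_mFourier_mul (hF n).1 _).1) (integrable_const (μ := torusMeasure) C) ?_ ?_
  · intro n
    filter_upwards [hC n] with t ht
    rw [smul_eq_mul, norm_mul]
    refine (mul_le_of_le_one_left (norm_nonneg _) ?_).trans ht
    exact ((mFourier (-k)).norm_coe_le_norm t).trans mFourier_norm.le
  · filter_upwards [hlim] with t ht
    exact ht.const_mul _

theorem integral_mFourier (n : Fin 2 → ℤ) (hn : n ≠ 0) : ∫ t, mFourier n t ∂torusMeasure = 0 := by
  have h : inner ℂ (mFourierLp 2 (0 : Fin 2 → ℤ)) (mFourierLp 2 n) = 0 :=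
    (orthonormal_mFourier (d := Fin 2)).2 hn.symm
  rw [ContinuousMap.inner_toLp] at h
  simpa [mFourier_zero] using! h

theorem mFourierCoeff_mFourier_of_ne {n k : Fin 2 → ℤ} (h : n ≠ k) :
    mFourierCoeff (mFourier n) k = 0 := by
  rw [mFourierCoeff_eq_integral_torusMeasure]
  simp only [← mFourier_add]
  exact integral_mFourier _ fun h' => h (by rwa [neg_add_eq_zero, eq_comm] at h')

theorem mFourier_mem_hardyGE {n : Fin 2 → ℤ} (h : ∀ i, c ≤ φ i n) :
    (mFourier n : Torus2 → ℂ) ∈ hardyGE φ c := by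
  refine ⟨(mFourier n).memLp_torusMeasure ∞, fun k hk => ?_⟩
  rcases eq_or_ne n k with rfl | hnk
  · exact h
  · exact absurd (mFourierCoeff_mFourier_of_ne hnk) hk

theorem const_mem_hardyGE (z : ℂ) : (fun _ => z) ∈ hardyGE φ 0 := by
  have h := (hardyGE φ 0).smul_mem z (mFourier_mem_hardyGE (φ := φ) (c := 0) (n := 0) (by simp))
  convert! h using 1
  ext t
  simp [mFourier_zero]

theorem integral_eq_zero_of_mem_hardyGE (hf : f ∈ hardyGE φ c) (hc : 0 < c) :
    ∫ t, f t ∂torusMeasure = 0 := by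
  by_contra h
  have := hf.2 0 (by simpa [mFourierCoeff_eq_integral_torusMeasure, mFourier_zero] using h) 0
  simp only [map_zero] at this
  linarith

/-- A nontrivial character of the torus takes the value `1` only on a null set. -/
theorem ae_mFourier_ne_one {n : Fin 2 → ℤ} (hn : n ≠ 0) :
    ∀ᵐ t ∂torusMeasure, mFourier n t ≠ 1 := by
  set S : Set Torus2 := {t | mFourier n t = 1}
  have hS : MeasurableSet S := (isClosed_eq (mFourier n).continuous continuous_const).measurableSet
  set h : Torus2 → ℂ := S.indicator fun _ => 1
  have hh : MemLp h 2 torusMeasure := (memLp_const 1).indicator hS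
  have hsum : Summable fun k => ‖mFourierCoeff (hh.toLp h) k‖ ^ 2 :=
    (hasSum_sq_mFourierCoeff (hh.toLp h)).summable
  -- On `S` all powers of the character equal `1`, so infinitely many coefficients of the indicator
  -- equal the measure of `S`; square summability makes it zero.
  have hco : ∀ m : ℕ, mFourierCoeff (hh.toLp h) (m • n) = torusMeasure.real S := by
    intro m
    rw [mFourierCoeff_eq_integral_torusMeasure]
    have : ∫ t, h t ∂torusMeasure = torusMeasure.real S := by
      rw [integral_indicator hS]; simp
    rw [← this]
    refine integral_congr_ae ?_
    filter_upwards [hh.coeFn_toLp] with t ht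
    rw [ht]
    by_cases hts : t ∈ S
    · have : ∀ m : ℕ, mFourier (m • n) t = 1 := by
        intro m
        induction m with
        | zero => simp [mFourier_zero]
        | succ m ih => rw [succ_nsmul, mFourier_add, ih, show mFourier n t = 1 from hts, mul_one]
      rw [mFourier_neg, this]; simp
    · simp [h, hts]
  have hinj : Function.Injective fun m : ℕ => m • n := by
    obtain ⟨i, hi⟩ := Function.ne_iff.1 hn
    intro a b hab
    have := congrFun hab i
    simpa [show n i ≠ 0 from hi] using this
  have h2 := hsum.comp_injective hinj
  have h3 : Summable fun _ : ℕ => torusMeasure.real S ^ 2 := by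
    refine h2.congr fun m => ?_
    simp only [Function.comp_apply, hco, Complex.norm_real, Real.norm_eq_abs, sq_abs]
  rw [summable_const_iff, sq_eq_zero_iff] at h3
  rw [ae_iff]
  simpa [measureReal_def, ENNReal.toReal_eq_zero_iff] using! h3

/-! ### Blocks of prescribed modulus -/

theorem pow_succ_mem_hardyGE (hc : 0 ≤ c) (hf : f ∈ hardyGE φ c) (n : ℕ) :
    (fun t => f t ^ (n + 1)) ∈ hardyGE φ c := by
  induction n with
  | zero => simpa using hf
  | succ n ih =>
    simp only [pow_succ _ (n + 1)]
    exact hardyGE_mono (by linarith) (mul_mem_hardyGE ih hf)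

/-- Removing the constant term of the exponential series leaves only powers of level at least `c`.
-/
theorem exp_sub_one_mem_hardyGE (hc : 0 ≤ c) (hf : f ∈ hardyGE φ c) (C : ℝ)
    (hC : ∀ t, ‖f t‖ ≤ C) : (fun t => Complex.exp (f t) - 1) ∈ hardyGE φ c := by
  have hs : ∀ t, HasSum (fun n : ℕ => ((n + 1).factorial : ℂ)⁻¹ * f t ^ (n + 1))
      (Complex.exp (f t) - 1) := by
    intro t
    have h := NormedSpace.exp_series_hasSum_exp' (𝕂 := ℂ) (f t)
    rw [← Complex.exp_eq_exp_ℂ] at h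
    simpa [smul_eq_mul] using (hasSum_nat_add_iff' 1).2 h
  refine hardyGE_of_tendsto
    (F := fun N t => ∑ n ∈ Finset.range N, ((n + 1).factorial : ℂ)⁻¹ * f t ^ (n + 1))
    (fun N => ?_) (Real.exp C) (fun N => ae_of_all _ fun t => ?_)
    (ae_of_all _ fun t => (hs t).tendsto_sum_nat)
  · have := (hardyGE φ c).sum_mem (t := Finset.range N)
      (f := fun n => ((n + 1).factorial : ℂ)⁻¹ • fun t => f t ^ (n + 1))
      fun n _ => (hardyGE φ c).smul_mem _ (pow_succ_mem_hardyGE hc hf n)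
    convert! this using 1
    ext t
    simp
  · have h := Real.sum_le_exp_of_nonneg (norm_nonneg (f t)) (N + 1)
    rw [Finset.sum_range_succ'] at h
    refine (norm_sum_le _ _).trans (le_trans ?_ (h.trans (Real.exp_le_exp.2 (hC t))))
    refine (Finset.sum_le_sum fun n _ => ?_).trans (le_add_of_nonneg_right (by simp))
    simp [div_eq_inv_mul]

/-- The map `z / (1 - z)` sends the unit disc to the half-plane `Re ≥ -1/2`. This bounds the radial
approximants of a block uniformly. -/
theorem re_div_one_sub {z : ℂ} (hz : ‖z‖ ≤ 1) (hz1 : z ≠ 1) :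
    -(1 / 2) ≤ (z / (1 - z)).re := by
  have h0 : (1 - z) ≠ 0 := sub_ne_zero.2 hz1.symm
  have hpos : 0 < Complex.normSq (1 - z) := Complex.normSq_pos.2 h0
  have hn : Complex.normSq z ≤ 1 := by
    rw [Complex.normSq_eq_norm_sq]; exact pow_le_one₀ (norm_nonneg _) hz
  rw [Complex.div_re, ← add_div, le_div_iff₀ hpos]
  simp only [Complex.normSq_apply, Complex.sub_re, Complex.sub_im, Complex.one_re,
    Complex.one_im] at hn ⊢
  nlinarith

theorem re_div_one_sub_of_norm_eq_one {z : ℂ} (hz : ‖z‖ = 1) (hz1 : z ≠ 1) :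
    (z / (1 - z)).re = -(1 / 2) := by
  have h0 : (1 - z) ≠ 0 := sub_ne_zero.2 hz1.symm
  have hpos : 0 < Complex.normSq (1 - z) := Complex.normSq_pos.2 h0
  have hn : Complex.normSq z = 1 := by
    rw [Complex.normSq_eq_norm_sq, hz, one_pow]
  rw [Complex.div_re, ← add_div, div_eq_iff hpos.ne']
  simp only [Complex.normSq_apply, Complex.sub_re, Complex.sub_im, Complex.one_re,
    Complex.one_im] at hn ⊢
  nlinarith

/-- The bounded function `exp (-p ζ / (1 - ζ))`, where `ζ` is a character of the torus. It has
modulus `exp (p / 2)` wherever `ζ ≠ 1`. -/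
noncomputable def outerBlock (p : C(Torus2, ℝ)) (n : Fin 2 → ℤ) (t : Torus2) : ℂ :=
  Complex.exp (-(p t : ℂ) * (mFourier n t / (1 - mFourier n t)))

theorem norm_mFourier_apply (n : Fin 2 → ℤ) (t : Torus2) : ‖mFourier n t‖ = 1 := by
  simp only [mFourier, ContinuousMap.coe_mk, norm_prod, fourier_apply, Circle.norm_coe,
    Finset.prod_const_one]

theorem norm_outerBlock_sq (p : C(Torus2, ℝ)) {n : Fin 2 → ℤ} {t : Torus2}
    (ht : mFourier n t ≠ 1) : ‖outerBlock p n t‖ ^ 2 = Real.exp (p t) := by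
  rw [outerBlock, Complex.norm_exp, ← Real.exp_nat_mul, ← Complex.ofReal_neg, Complex.re_ofReal_mul,
    re_div_one_sub_of_norm_eq_one (norm_mFourier_apply n t) ht]
  congr 1
  push_cast
  ring

/-- In the geometric series each term carries at least one factor of the character, whose level `c +
d` absorbs the `-d` of `p`. -/
theorem mul_geom_mem_hardyGE {d : ℝ} (hc : 0 ≤ c) (hd : 0 ≤ d) (p : C(Torus2, ℝ))
    (hp : (fun t => (p t : ℂ)) ∈ hardyGE φ (-d)) {n : Fin 2 → ℤ} (hn : ∀ i, c + d ≤ φ i n)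
    {r : ℝ} (hr0 : 0 ≤ r) (hr1 : r < 1) :
    (fun t => -(p t : ℂ) * (r * mFourier n t / (1 - r * mFourier n t))) ∈ hardyGE φ c := by
  have hz : ∀ t, ‖(r : ℂ) * mFourier n t‖ = r := fun t => by
    rw [norm_mul, norm_mFourier_apply, mul_one, Complex.norm_real, Real.norm_of_nonneg hr0]
  have hterm : ∀ m : ℕ, (fun t => -(p t : ℂ) * (r * mFourier n t) ^ (m + 1)) ∈ hardyGE φ c := by
    intro m
    have h1 := pow_succ_mem_hardyGE (c := c + d) (by linarith)
      (mFourier_mem_hardyGE (φ := φ) hn) m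
    have h2 := (hardyGE φ _).smul_mem (-(r : ℂ) ^ (m + 1)) (mul_mem_hardyGE hp h1)
    convert! hardyGE_mono (c := c) (by linarith) h2 using 1
    ext t
    simp only [Pi.smul_apply, smul_eq_mul]
    ring
  refine hardyGE_of_tendsto
    (F := fun N t => ∑ m ∈ Finset.range N, -(p t : ℂ) * (r * mFourier n t) ^ (m + 1))
    (fun N => ?_) (‖p‖ * (1 - r)⁻¹) (fun N => ae_of_all _ fun t => ?_)
    (ae_of_all _ fun t => HasSum.tendsto_sum_nat ?_)
  · convert! (hardyGE φ c).sum_mem (t := Finset.range N) fun m _ => hterm m using 1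
    ext t
    simp
  · rw [← Finset.mul_sum, norm_mul, norm_neg, Complex.norm_real]
    refine mul_le_mul (p.norm_coe_le_norm t) ?_ (norm_nonneg _) (norm_nonneg _)
    refine (norm_sum_le _ _).trans ?_
    simp only [norm_pow, hz]
    refine le_trans ?_ ((summable_geometric_of_lt_one hr0 hr1).sum_le_tsum (Finset.range N)
      (fun i _ => by positivity) |>.trans_eq (tsum_geometric_of_lt_one hr0 hr1))
    exact Finset.sum_le_sum fun m _ => pow_le_pow_of_le_one hr0 hr1.le (Nat.le_succ m)
  · have hz1 : ‖(r : ℂ) * mFourier n t‖ < 1 := by rw [hz]; exact hr1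
    generalize (r : ℂ) * mFourier n t = z at hz1
    refine HasSum.mul_left _ ?_
    simpa only [pow_succ', div_eq_mul_inv] using
      (hasSum_geometric_of_norm_lt_one hz1).mul_left z

/-- The character is replaced by `r` times itself and `r` tends to `1`. Since `p ≥ 0`, the
exponentials stay bounded by `exp (‖p‖ / 2)` independently of `r`. -/
theorem outerBlock_sub_one_mem_hardyGE {d : ℝ} (hc : 0 ≤ c) (hd : 0 ≤ d) (p : C(Torus2, ℝ))
    (hp0 : ∀ t, 0 ≤ p t) (hp : (fun t => (p t : ℂ)) ∈ hardyGE φ (-d)) {n : Fin 2 → ℤ}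
    (hn0 : n ≠ 0) (hn : ∀ i, c + d ≤ φ i n) :
    (fun t => outerBlock p n t - 1) ∈ hardyGE φ c := by
  set r : ℕ → ℝ := fun l => 1 - ((l : ℝ) + 1)⁻¹
  have hr0 : ∀ l, 0 ≤ r l := fun l =>
    sub_nonneg.2 (inv_le_one_of_one_le₀ (by linarith [Nat.cast_nonneg (α := ℝ) l]))
  have hr1 : ∀ l, r l < 1 := fun l => sub_lt_self _ (by positivity)
  have hlim : Tendsto r atTop (𝓝 1) := by
    simpa [r] using (tendsto_const_nhds (x := (1 : ℝ))).sub tendsto_one_div_add_atTop_nhds_zero_nat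
  have hz : ∀ l t, ‖(r l : ℂ) * mFourier n t‖ = r l := fun l t => by
    rw [norm_mul, norm_mFourier_apply, mul_one, Complex.norm_real, Real.norm_of_nonneg (hr0 l)]
  have hz1 : ∀ l t, (r l : ℂ) * mFourier n t ≠ 1 := fun l t h => by
    have := hz l t
    rw [h, norm_one] at this
    exact (hr1 l).ne' this
  refine hardyGE_of_tendsto (F := fun l t =>
      Complex.exp (-(p t : ℂ) * (r l * mFourier n t / (1 - r l * mFourier n t))) - 1)
    (fun l => exp_sub_one_mem_hardyGE hc (mul_geom_mem_hardyGE hc hd p hp hn (hr0 l) (hr1 l))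
      (‖p‖ * (r l / (1 - r l))) fun t => ?_) (Real.exp (‖p‖ / 2) + 1)
    (fun l => ae_of_all _ fun t => ?_) ?_
  · rw [norm_mul, norm_neg, Complex.norm_real, norm_div, hz]
    have h1 : 1 - r l ≤ ‖1 - (r l : ℂ) * mFourier n t‖ := by
      have := norm_sub_norm_le (1 : ℂ) ((r l : ℂ) * mFourier n t)
      rwa [hz, norm_one] at this
    have h2 := sub_pos.2 (hr1 l)
    have h3 := hr0 l
    gcongr
    exact p.norm_coe_le_norm t
  · refine (norm_sub_le _ _).trans ?_
    rw [norm_one, Complex.norm_exp, ← Complex.ofReal_neg, Complex.re_ofReal_mul]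
    have h1 := re_div_one_sub ((hz l t).trans_le (hr1 l).le) (hz1 l t)
    have h2 : p t ≤ ‖p‖ := (le_abs_self _).trans (p.norm_coe_le_norm t)
    gcongr
    nlinarith [hp0 t]
  · filter_upwards [ae_mFourier_ne_one hn0] with t ht
    have h1 : Tendsto (fun l => (r l : ℂ) * mFourier n t) atTop (𝓝 (mFourier n t)) := by
      simpa using ((Complex.continuous_ofReal.tendsto 1).comp hlim).mul_const (mFourier n t)
    refine Tendsto.sub_const (Complex.continuous_exp.continuousAt.tendsto.comp
      (Tendsto.const_mul _ (h1.div (h1.const_sub 1) (sub_ne_zero.2 ht.symm)))) _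

/-! ### Approximation by trigonometric polynomials -/

theorem exists_mem_hardyGE_of_mem_span {P : C(Torus2, ℂ)}
    (hP : P ∈ Submodule.span ℂ (Set.range (mFourier (d := Fin 2)))) :
    ∃ d : ℝ, 0 ≤ d ∧ (P : Torus2 → ℂ) ∈ hardyGE φ (-d) ∧
      (fun t => conj (P t)) ∈ hardyGE φ (-d) := by
  induction hP using Submodule.span_induction with
  | mem x hx =>
    obtain ⟨n, rfl⟩ := hx
    have h : ∀ i, |φ i n| ≤ |φ 0 n| + |φ 1 n| := by
      intro i
      fin_cases i
      · exact le_add_of_nonneg_right (abs_nonneg _)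
      · exact le_add_of_nonneg_left (abs_nonneg _)
    refine ⟨|φ 0 n| + |φ 1 n|, by positivity, mFourier_mem_hardyGE fun i => ?_, ?_⟩
    · linarith [neg_abs_le (φ i n), h i]
    · simp only [← mFourier_neg]
      refine mFourier_mem_hardyGE fun i => ?_
      rw [map_neg]
      linarith [le_abs_self (φ i n), h i]
  | zero =>
    refine ⟨0, le_rfl, (hardyGE φ _).zero_mem, ?_⟩
    convert! (hardyGE φ (-0)).zero_mem using 1
    ext t
    simp
  | add x y _ _ hx hy =>
    obtain ⟨d, hd, h1, h2⟩ := hx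
    obtain ⟨d', hd', h1', h2'⟩ := hy
    refine ⟨d + d', by positivity, (hardyGE φ _).add_mem (hardyGE_mono (by linarith) h1)
      (hardyGE_mono (by linarith) h1'), ?_⟩
    convert! (hardyGE φ (-(d + d'))).add_mem (hardyGE_mono (by linarith) h2)
      (hardyGE_mono (by linarith) h2') using 1
    ext t
    simp
  | smul z x _ hx =>
    obtain ⟨d, hd, h1, h2⟩ := hx
    refine ⟨d, hd, (hardyGE φ _).smul_mem z h1, ?_⟩
    convert! (hardyGE φ _).smul_mem (conj z) h2 using 1
    ext t
    simp

/-- Trigonometric polynomials are dense in the continuous functions. -/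
theorem exists_hardyGE_near (φ : Fin 2 → (Fin 2 → ℤ) →+ ℝ) (g : C(Torus2, ℂ)) {ε : ℝ}
    (hε : 0 < ε) : ∃ (P : C(Torus2, ℂ)) (d : ℝ), 0 ≤ d ∧ (∀ t, ‖g t - P t‖ < ε) ∧
      (P : Torus2 → ℂ) ∈ hardyGE φ (-d) ∧ (fun t => conj (P t)) ∈ hardyGE φ (-d) := by
  have hg : g ∈ (Submodule.span ℂ (Set.range (mFourier (d := Fin 2)))).topologicalClosure := by
    rw [span_mFourier_closure_eq_top]; trivial
  obtain ⟨P, hP, hPg⟩ := Metric.mem_closure_iff.1 hg ε hε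
  obtain ⟨d, hd, h1, h2⟩ := exists_mem_hardyGE_of_mem_span (φ := φ) hP
  refine ⟨P, d, hd, fun t => ?_, h1, h2⟩
  rw [← dist_eq_norm]
  exact (ContinuousMap.dist_apply_le_dist t).trans_lt hPg

/-- Real trigonometric polynomials are dense in the real continuous functions. -/
theorem exists_real_hardyGE_near (φ : Fin 2 → (Fin 2 → ℤ) →+ ℝ) (g : C(Torus2, ℝ)) {ε : ℝ}
    (hε : 0 < ε) : ∃ (q : C(Torus2, ℝ)) (d : ℝ), 0 ≤ d ∧ (∀ t, |g t - q t| < ε) ∧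
      (fun t => (q t : ℂ)) ∈ hardyGE φ (-d) := by
  obtain ⟨P, d, hd, hP, h1, h2⟩ := exists_hardyGE_near φ
    (⟨fun t => (g t : ℂ), by fun_prop⟩ : C(Torus2, ℂ)) hε
  refine ⟨⟨fun t => (P t).re, by fun_prop⟩, d, hd, fun t => ?_, ?_⟩
  · refine lt_of_le_of_lt ?_ (hP t)
    simpa using Complex.abs_re_le_norm ((g t : ℂ) - P t)
  · convert! (hardyGE φ _).smul_mem (1 / 2 : ℂ) ((hardyGE φ _).add_mem h1 h2) using 1
    ext t
    simp [Complex.add_conj]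

/-- The product `P h` has positive level `c - d`, hence mean zero; only the error `g - P`
contributes. -/
theorem norm_integral_mul_le_of_mem_hardyGE {P g h : Torus2 → ℂ} {c d C ε : ℝ} (hdc : d < c)
    (hP : P ∈ hardyGE φ (-d)) (hh : h ∈ hardyGE φ c) (hg : MemLp g ∞ torusMeasure)
    (hC : ∀ᵐ t ∂torusMeasure, ‖h t‖ ≤ C) (hε : ∀ t, ‖g t - P t‖ ≤ ε) :
    ‖∫ t, g t * h t ∂torusMeasure‖ ≤ ε * C := by
  have h0 : ∫ t, P t * h t ∂torusMeasure = 0 :=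
    integral_eq_zero_of_mem_hardyGE (mul_mem_hardyGE hP hh) (by linarith)
  have hi1 : Integrable (fun t => g t * h t) torusMeasure :=
    memLp_one_iff_integrable.1 ((hg.mul_of_top hh.1).mono_exponent le_top)
  have hi2 : Integrable (fun t => P t * h t) torusMeasure :=
    memLp_one_iff_integrable.1 ((hP.1.mul_of_top hh.1).mono_exponent le_top)
  rw [← sub_zero (∫ t, g t * h t ∂torusMeasure), ← h0, ← integral_sub hi1 hi2]
  refine (norm_integral_le_of_norm_le_const (C := ε * C) ?_).trans (by simp)
  filter_upwards [hC] with t ht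
  rw [← sub_mul, norm_mul]
  exact mul_le_mul (hε t) ht (norm_nonneg _) ((norm_nonneg _).trans (hε t))

/-! ### Raising the modulus -/

theorem ContinuousMap.integrable_exp_torusMeasure (q : C(Torus2, ℝ)) :
    Integrable (fun t => Real.exp (q t)) torusMeasure :=
  (Real.continuous_exp.comp q.continuous).integrable_of_hasCompactSupport
    (HasCompactSupport.of_compactSpace _)

theorem exists_nsmul_ge {a : Fin 2 → ℤ} (ha : ∀ i, 0 < φ i a) (x : ℝ) :
    ∃ N : ℕ, ∀ i, x ≤ φ i (N • a) := by
  obtain ⟨N₀, h0⟩ := Archimedean.arch x (ha 0)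
  obtain ⟨N₁, h1⟩ := Archimedean.arch x (ha 1)
  refine ⟨N₀ + N₁, fun i => ?_⟩
  rw [add_nsmul, map_add, map_nsmul, map_nsmul]
  fin_cases i
  · exact h0.trans (le_add_of_nonneg_right (nsmul_nonneg (ha 0).le _))
  · exact h1.trans (le_add_of_nonneg_left (nsmul_nonneg (ha 1).le _))

/-- Raising the modulus of a bounded function with spectrum in the cone from `exp (q / 2)` to
`exp (q' / 2)`, at a controlled cost in `L²`. -/
theorem exists_hardyGE_raise {a : Fin 2 → ℤ} (ha : ∀ i, 0 < φ i a) {A : Torus2 → ℂ}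
    (hA : A ∈ hardyGE φ 0) (q q' : C(Torus2, ℝ))
    (hq : ∀ᵐ t ∂torusMeasure, ‖A t‖ ^ 2 = Real.exp (q t)) (hle : ∀ t, q t ≤ q' t) {d : ℝ}
    (hd : 0 ≤ d) (hp : (fun t => ((q' - q) t : ℂ)) ∈ hardyGE φ (-d)) {ε : ℝ} (hε : 0 < ε) :
    ∃ B ∈ hardyGE φ 0, (∀ᵐ t ∂torusMeasure, ‖B t‖ ^ 2 = Real.exp (q' t)) ∧
      ∫ t, ‖B t - A t‖ ^ 2 ∂torusMeasure
        ≤ ∫ t, Real.exp (q' t) ∂torusMeasure - ∫ t, Real.exp (q t) ∂torusMeasure + ε := by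
  set p : C(Torus2, ℝ) := q' - q with hpdef
  -- Bounds `|α - 1|` through `|α| ≤ |α|² + 1`.
  set C : ℝ := Real.exp ‖p‖ + 1 + 1 with hCdef
  have hCpos : 0 < C := by positivity
  set E : C(Torus2, ℂ) := ⟨fun t => (Real.exp (q t) : ℂ), by fun_prop⟩ with hE
  obtain ⟨P, D, hD, hEP, hP, -⟩ := exists_hardyGE_near φ E (ε := ε / (2 * C)) (by positivity)
  -- Level `D + 1` for `α - 1` strictly beats the `-D` of `P`, and `d` pays for `p`.
  obtain ⟨N, hN⟩ := exists_nsmul_ge ha (D + 1 + d)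
  set n := N • a
  have hn0 : n ≠ 0 := by
    intro h
    have := hN 0
    rw [h, map_zero] at this
    linarith
  have hα := outerBlock_sub_one_mem_hardyGE (by linarith) hd p
    (fun t => sub_nonneg.2 (hle t)) hp hn0 hN
  have hαne := ae_mFourier_ne_one hn0
  set α := outerBlock p n
  have hα0 : α ∈ hardyGE φ 0 := by
    convert! (hardyGE φ 0).add_mem (hardyGE_mono (by linarith) hα) (const_mem_hardyGE 1) using 1
    ext t
    simp
  have hnorm : ∀ᵐ t ∂torusMeasure, ‖α t‖ ^ 2 = Real.exp (p t) := by
    filter_upwards [hαne] with t ht using norm_outerBlock_sq p ht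
  have hαC : ∀ᵐ t ∂torusMeasure, ‖α t - 1‖ ≤ C := by
    filter_upwards [hnorm] with t ht
    have h1 : Real.exp (p t) ≤ Real.exp ‖p‖ :=
      Real.exp_le_exp.2 ((le_abs_self _).trans (p.norm_coe_le_norm t))
    have h2 := norm_sub_le (α t) 1
    rw [norm_one] at h2
    nlinarith [sq_nonneg (‖α t‖ - 1)]
  refine ⟨fun t => A t * α t, by simpa using mul_mem_hardyGE hA hα0, ?_, ?_⟩
  · filter_upwards [hq, hnorm] with t h1 h2
    rw [norm_mul, mul_pow, h1, h2, ← Real.exp_add, hpdef]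
    simp
  · have hsmall := norm_integral_mul_le_of_mem_hardyGE (by linarith) hP hα
      (E.memLp_torusMeasure ∞) hαC fun t => (hEP t).le
    have hI : Integrable (fun t => E t * (α t - 1)) torusMeasure :=
      memLp_one_iff_integrable.1
        (((E.memLp_torusMeasure ∞).mul_of_top hα.1).mono_exponent le_top)
    have hexp := ContinuousMap.integrable_exp_torusMeasure
    -- Expanding the square isolates the cross term, whose integral is small by `hsmall`.
    have hpt : ∀ᵐ t ∂torusMeasure, ‖A t * α t - A t‖ ^ 2
        = Real.exp (q' t) - Real.exp (q t) - 2 * (E t * (α t - 1)).re := by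
      filter_upwards [hq, hnorm] with t h1 h2
      have h3 : Real.exp (q' t) = Real.exp (q t) * ‖α t‖ ^ 2 := by
        rw [h2, ← Real.exp_add, hpdef]; simp
      have h4 : ‖α t - 1‖ ^ 2 = ‖α t‖ ^ 2 + 1 - 2 * (α t).re := by
        rw [← Complex.normSq_eq_norm_sq, ← Complex.normSq_eq_norm_sq, Complex.normSq_apply,
          Complex.normSq_apply]
        simp only [Complex.sub_re, Complex.sub_im, Complex.one_re, Complex.one_im]
        ring
      rw [← mul_sub_one, norm_mul, mul_pow, h1, h3, h4]
      simp only [hE, ContinuousMap.coe_mk, Complex.re_ofReal_mul, Complex.sub_re, Complex.one_re]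
      ring
    have hI1 : Integrable (fun t => Real.exp (q' t) - Real.exp (q t)) torusMeasure :=
      (hexp q').sub (hexp q)
    have hI2 : Integrable (fun t => 2 * (E t * (α t - 1)).re) torusMeasure := hI.re.const_mul 2
    rw [integral_congr_ae hpt, integral_sub hI1 hI2,
      integral_sub (hexp q') (hexp q), integral_const_mul]
    have hre : ∫ t, (E t * (α t - 1)).re ∂torusMeasure = (∫ t, E t * (α t - 1) ∂torusMeasure).re :=
      integral_re hI
    rw [hre]
    have h5 := (Complex.abs_re_le_norm _).trans hsmall
    have h6 : ε / (2 * C) * C = ε / 2 := by field_simp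
    rw [h6] at h5
    linarith [neg_abs_le (∫ t, E t * (α t - 1) ∂torusMeasure).re]

/-! ### Lower semicontinuous functions as increasing limits -/

/-- Baire's theorem: a lower semicontinuous function bounded below on a metric space is the
pointwise limit of an increasing sequence of continuous functions. -/
theorem LowerSemicontinuous.exists_monotone_continuous_tendsto {X : Type*} [PseudoMetricSpace X]
    {f : X → ℝ} (hf : LowerSemicontinuous f) {m : ℝ} (hm : ∀ x, m ≤ f x) :
    ∃ g : ℕ → X → ℝ, (∀ n, Continuous (g n)) ∧ (∀ n x, g n x ≤ g (n + 1) x) ∧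
      (∀ n x, m ≤ g n x) ∧ ∀ x, Tendsto (fun n => g n x) atTop (𝓝 (f x)) := by
  have hb : ∀ (n : ℕ) (x : X), BddBelow (Set.range fun y => f y + n * dist x y) := by
    refine fun n x => ⟨m, ?_⟩
    rintro _ ⟨y, rfl⟩
    exact le_add_of_le_of_nonneg (hm y) (by positivity)
  have hle : ∀ (n : ℕ) (x : X), ⨅ y, f y + n * dist x y ≤ f x := fun n x => by
    simpa using ciInf_le (hb n x) x
  -- The infimal convolution with `n * dist` is `n`-Lipschitz and increases with `n`.
  refine ⟨fun n x => ⨅ y, f y + n * dist x y, fun n => ?_, fun n x => ?_, fun n x => ?_,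
    fun x => ?_⟩
  · refine (LipschitzWith.of_le_add_mul (n : NNReal) fun x x' => ?_).continuous
    have : Nonempty X := ⟨x⟩
    rw [← sub_le_iff_le_add]
    refine le_ciInf fun y => ?_
    rw [sub_le_iff_le_add]
    refine (ciInf_le (hb n x) y).trans ?_
    have := dist_triangle x x' y
    have hn : (0 : ℝ) ≤ n := n.cast_nonneg
    simp only [NNReal.coe_natCast]
    nlinarith
  · have : Nonempty X := ⟨x⟩
    refine ciInf_mono (hb n x) fun y => ?_
    push_cast
    gcongr
    linarith
  · have : Nonempty X := ⟨x⟩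
    exact le_ciInf fun y => le_add_of_le_of_nonneg (hm y) (by positivity)
  · have : Nonempty X := ⟨x⟩
    refine tendsto_order.2 ⟨fun v hv => ?_, fun v hv => Eventually.of_forall fun n =>
      (hle n x).trans_lt hv⟩
    obtain ⟨w, hvw, hw⟩ := exists_between hv
    obtain ⟨δ, hδ, hball⟩ := Metric.eventually_nhds_iff.1 (hf x w hw)
    obtain ⟨N, hN⟩ := exists_nat_ge ((w - m) / δ)
    filter_upwards [eventually_ge_atTop N] with n hn
    refine hvw.trans_le (le_ciInf fun y => ?_)
    rcases lt_or_ge (dist y x) δ with h | h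
    · exact le_add_of_le_of_nonneg (hball h).le (by positivity)
    · have h1 : (N : ℝ) ≤ n := by exact_mod_cast hn
      have h2 : w - m ≤ n * δ := (div_le_iff₀ hδ).1 (hN.trans h1)
      have h3 : (n : ℝ) * δ ≤ n * dist x y := by rw [dist_comm]; gcongr
      linarith [hm y]

/-- A positive lower semicontinuous function on the torus is the pointwise increasing limit of
exponentials of real trigonometric polynomials. -/
theorem exists_monotone_exp_tendsto (φ : Fin 2 → (Fin 2 → ℤ) →+ ℝ) {f : Torus2 → ℝ}
    (hpos : ∀ t, 0 < f t) (hlsc : LowerSemicontinuous f) :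
    ∃ (q : ℕ → C(Torus2, ℝ)) (d : ℕ → ℝ), (∀ n, 0 ≤ d n) ∧
      (∀ n, (fun t => (q n t : ℂ)) ∈ hardyGE φ (-d n)) ∧ Monotone q ∧
      ∀ t, Tendsto (fun n => Real.exp (q n t)) atTop (𝓝 (f t)) := by
  obtain ⟨t₀, -, ht₀⟩ := (hlsc.lowerSemicontinuousOn Set.univ).exists_isMinOn
    ⟨(0 : Torus2), Set.mem_univ _⟩ isCompact_univ
  have hm : ∀ t, f t₀ ≤ f t := fun t => ht₀ (Set.mem_univ t)
  obtain ⟨g, hgc, hgmono, hgm, hglim⟩ := hlsc.exists_monotone_continuous_tendsto hm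
  have hgpos : ∀ n t, 0 < g n t := fun n t => (hpos t₀).trans_le (hgm n t)
  set δ : ℕ → ℝ := fun n => (1 / 2) ^ n with hδ
  have hδpos : ∀ n, 0 < δ n := fun n => by positivity
  -- With error `δ n` and `δ (n + 1) = δ n / 2`, the shift gives `q n < log (g n) - 3 δ n`, below
  -- `log (g (n + 1)) - (5/2) δ n < q (n + 1)`.
  choose q d hd hq hqd using fun n => exists_real_hardyGE_near φ
    (⟨fun t => Real.log (g n t) - 4 * δ n,
      ((hgc n).log fun t => (hgpos n t).ne').sub continuous_const⟩ : C(Torus2, ℝ)) (hδpos n)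
  simp only [ContinuousMap.coe_mk] at hq
  refine ⟨q, d, hd, hqd, monotone_nat_of_le_succ fun n t => ?_, fun t => ?_⟩
  · have h1 := abs_lt.1 (hq n t)
    have h2 := abs_lt.1 (hq (n + 1) t)
    have h3 := Real.log_le_log (hgpos n t) (hgmono n t)
    have h4 : δ (n + 1) = δ n / 2 := by simp only [hδ, pow_succ]; ring
    rw [h4] at h2
    change q n t ≤ q (n + 1) t
    linarith [hδpos n]
  · have hδ0 : Tendsto δ atTop (𝓝 0) :=
      tendsto_pow_atTop_nhds_zero_of_lt_one (by norm_num) (by norm_num)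
    have h1 : Tendsto (fun n => Real.log (g n t)) atTop (𝓝 (Real.log (f t))) :=
      (Real.continuousAt_log (hpos t).ne').tendsto.comp (hglim t)
    have h2 : Tendsto (fun n => q n t) atTop (𝓝 (Real.log (f t))) := by
      refine tendsto_of_tendsto_of_tendsto_of_le_of_le (g := fun n => Real.log (g n t) - 5 * δ n)
        (h := fun n => Real.log (g n t)) ?_ h1 (fun n => ?_) fun n => ?_
      · simpa using h1.sub (hδ0.const_mul 5)
      · simp only
        linarith [(abs_lt.1 (hq n t)).2]
      · simp only
        linarith [(abs_lt.1 (hq n t)).1, hδpos n]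
    have h3 := (Real.continuous_exp.tendsto _).comp h2
    rwa [Real.exp_log (hpos t)] at h3

/-! ### Functionals defining the cone -/

/-- A planar half-cone is cut out by two linear functionals, both positive at some lattice point. -/
theorem IsHalfCone.exists_functionals {K : Set (Fin 2 → ℝ)} (hK : IsHalfCone K) :
    ∃ (φ : Fin 2 → (Fin 2 → ℤ) →+ ℝ) (a : Fin 2 → ℤ), (∀ i, 0 < φ i a) ∧
      ∀ k : Fin 2 → ℤ, (∀ i, 0 ≤ φ i k) → (fun i => (k i : ℝ)) ∈ K := by
  obtain ⟨e₁, e₂, hli, rfl⟩ := hK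
  set b := basisOfLinearIndependentOfCardEqFinrank hli (by simp)
  have hb : ∀ v, v = b.repr v 0 • e₁ + b.repr v 1 • e₂ := fun v => by
    simpa [b] using (b.sum_repr v).symm
  set ψ : Fin 2 → (Fin 2 → ℝ) →ₗ[ℝ] ℝ := fun i => b.coord i
  have hψ : ∀ i v, ψ i v = v 0 * ψ i (Pi.single 0 1) + v 1 * ψ i (Pi.single 1 1) := by
    intro i v
    conv_lhs => rw [show v = v 0 • Pi.single 0 1 + v 1 • Pi.single 1 1 by
      ext j; fin_cases j <;> simp]
    rw [map_add, map_smul, map_smul, smul_eq_mul, smul_eq_mul]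
  set ι : (Fin 2 → ℤ) →+ (Fin 2 → ℝ) := (Int.castAddHom ℝ).compLeft (Fin 2)
  have hv : ∀ i, ψ i (e₁ + e₂) = 1 := by
    intro i
    have h1 : e₁ = b 0 := by simp [b]
    have h2 : e₂ = b 1 := by simp [b]
    rw [h1, h2]
    fin_cases i <;> simp [ψ]
  -- Both coordinates of `M • (e₁ + e₂)` equal `M`, which exceeds the loss from rounding down to a
  -- lattice point.
  set M : ℝ := ∑ i, (|ψ i (Pi.single 0 1)| + |ψ i (Pi.single 1 1)|) + 1
  set a : Fin 2 → ℤ := fun j => ⌊M * (e₁ + e₂) j⌋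
  refine ⟨fun i => (ψ i).toAddMonoidHom.comp ι, a, fun i => ?_, fun k hk => ?_⟩
  · change 0 < ψ i (ι a)
    have hsub : ι a = M • (e₁ + e₂) - fun j => Int.fract (M * (e₁ + e₂) j) := by
      ext j
      simp only [ι, a, AddMonoidHom.compLeft_apply, Function.comp_apply, Pi.sub_apply,
        Pi.smul_apply, smul_eq_mul, Int.coe_castAddHom]
      exact (Int.self_sub_fract _).symm
    rw [hsub, map_sub, map_smul, hv, hψ i fun j => Int.fract (M * (e₁ + e₂) j)]
    have hfr : ∀ x y : ℝ, Int.fract x * y ≤ |y| := fun x y =>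
      (le_abs_self _).trans (by
        rw [abs_mul, abs_of_nonneg (Int.fract_nonneg x)]
        exact mul_le_of_le_one_left (abs_nonneg y) (Int.fract_lt_one x).le)
    have h1 := hfr (M * (e₁ + e₂) 0) (ψ i (Pi.single 0 1))
    have h2 := hfr (M * (e₁ + e₂) 1) (ψ i (Pi.single 1 1))
    have h3 := Finset.single_le_sum
      (f := fun i => |ψ i (Pi.single 0 1)| + |ψ i (Pi.single 1 1)|)
      (fun i _ => by positivity) (Finset.mem_univ i)
    simp only [smul_eq_mul, mul_one, M] at h1 h2 h3 ⊢
    linarith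
  · exact ⟨ψ 0 (ι k), ψ 1 (ι k), hk 0, hk 1, hb _⟩

/-! ### Passage to the limit in `L²` -/

theorem norm_toLp_two_sq (hf : MemLp f 2 torusMeasure) :
    ‖hf.toLp f‖ ^ 2 = ∫ t, ‖f t‖ ^ 2 ∂torusMeasure := by
  have h0 : 0 ≤ ∫ t, ‖f t‖ ^ 2 ∂torusMeasure := integral_nonneg fun t => by positivity
  rw [Lp.norm_toLp, hf.eLpNorm_eq_integral_rpow_norm (by simp) (by simp),
    ENNReal.toReal_ofReal (by positivity)]
  simp only [ENNReal.toReal_ofNat, Real.rpow_two]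
  rw [← Real.rpow_natCast, ← Real.rpow_mul h0]
  norm_num

/-- An `L²`-fast sequence of bounded functions with spectrum in the cone and increasing squared
moduli has a limit of the same kind. -/
theorem exists_hardyGE_limit {A : ℕ → Torus2 → ℂ} (hA : ∀ n, A n ∈ hardyGE φ 0)
    {F : Torus2 → ℝ} {q : ℕ → Torus2 → ℝ} {C : ℝ}
    (hq : ∀ n, ∀ᵐ t ∂torusMeasure, ‖A n t‖ ^ 2 = q n t)
    (hC : ∀ n, ∀ᵐ t ∂torusMeasure, q n t ≤ C)
    (hlim : ∀ t, Tendsto (fun n => q n t) atTop (𝓝 (F t)))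
    (hstep : ∀ n, ∫ t, ‖A (n + 1) t - A n t‖ ^ 2 ∂torusMeasure ≤ (2 * (1 / 2) ^ n) ^ 2) :
    ∃ G ∈ hardyGE φ 0, ∀ᵐ t ∂torusMeasure, ‖G t‖ ^ 2 = F t := by
  have hL : ∀ n, MemLp (A n) 2 torusMeasure := fun n => (hA n).1.mono_exponent le_top
  have hcau : CauchySeq fun n => (hL n).toLp (A n) := by
    refine cauchySeq_of_le_geometric (1 / 2) 2 (by norm_num) fun n => ?_
    rw [dist_comm, dist_eq_norm, ← MemLp.toLp_sub]
    refine le_of_sq_le_sq ?_ (by positivity)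
    rw [norm_toLp_two_sq]
    exact hstep n
  obtain ⟨G, hG⟩ := cauchySeq_tendsto_of_complete hcau
  obtain ⟨ns, hns, hae⟩ := (tendstoInMeasure_of_tendsto_Lp hG).exists_seq_tendsto_ae
  have hae' : ∀ᵐ t ∂torusMeasure, Tendsto (fun i => A (ns i) t) atTop (𝓝 (G t)) := by
    filter_upwards [hae, ae_all_iff.2 fun n => (hL n).coeFn_toLp] with t h1 h2
    simpa only [h2] using h1
  refine ⟨G, hardyGE_of_tendsto (fun i => hA (ns i)) (C + 1) (fun i => ?_) hae', ?_⟩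
  · filter_upwards [hq (ns i), hC (ns i)] with t h1 h2
    nlinarith [sq_nonneg (‖A (ns i) t‖ - 1)]
  · filter_upwards [hae', ae_all_iff.2 hq] with t h1 h2
    refine tendsto_nhds_unique (h1.norm.pow 2) ?_
    simpa only [h2, Function.comp_def] using (hlim t).comp hns.tendsto_atTop

theorem sub_mem_hardyGE_of_real {q q' : C(Torus2, ℝ)} {d d' : ℝ} (hd : 0 ≤ d) (hd' : 0 ≤ d')
    (hq : (fun t => (q t : ℂ)) ∈ hardyGE φ (-d)) (hq' : (fun t => (q' t : ℂ)) ∈ hardyGE φ (-d')) :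
    (fun t => ((q' - q) t : ℂ)) ∈ hardyGE φ (-(d + d')) := by
  convert! (hardyGE φ (-(d + d'))).sub_mem (hardyGE_mono (by linarith) hq')
    (hardyGE_mono (by linarith) hq) using 1
  ext t
  simp

/-- Every exponential of a real trigonometric polynomial is the squared modulus of a bounded
function with spectrum in the cone. -/
theorem exists_hardyGE_norm_sq_eq_exp {a : Fin 2 → ℤ} (ha : ∀ i, 0 < φ i a) (q : C(Torus2, ℝ))
    {d : ℝ} (hd : 0 ≤ d) (hq : (fun t => (q t : ℂ)) ∈ hardyGE φ (-d)) :
    ∃ A ∈ hardyGE φ 0, ∀ᵐ t ∂torusMeasure, ‖A t‖ ^ 2 = Real.exp (q t) := by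
  have hconst := sub_mem_hardyGE_of_real (q := ContinuousMap.const _ (-‖q‖)) le_rfl hd
    (by simpa using const_mem_hardyGE (φ := φ) (-(‖q‖ : ℂ))) hq
  -- The starting point is a constant of squared modulus `exp (-‖q‖)`, which lies below `exp q`; the
  -- `L²` cost is irrelevant here.
  obtain ⟨A, hA, hA', -⟩ := exists_hardyGE_raise ha
    (const_mem_hardyGE (Real.exp (-‖q‖ / 2) : ℂ)) (ContinuousMap.const _ (-‖q‖)) q
    (ae_of_all _ fun t => by
      rw [Complex.norm_real, Real.norm_of_nonneg (Real.exp_pos _).le,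
        ← Real.exp_nat_mul, ContinuousMap.const_apply]
      congr 1
      push_cast
      ring)
    (fun t => (abs_le.1 (q.norm_coe_le_norm t)).1) (by linarith) hconst one_pos
  exact ⟨A, hA, hA'⟩

theorem exists_hardyGE_norm_sq_eq {a : Fin 2 → ℤ} (ha : ∀ i, 0 < φ i a) {F : Torus2 → ℝ}
    (hpos : ∀ t, 0 < F t) (hbdd : MemLp F ∞ torusMeasure) (hlsc : LowerSemicontinuous F) :
    ∃ G ∈ hardyGE φ 0, ∀ᵐ t ∂torusMeasure, ‖G t‖ ^ 2 = F t := by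
  obtain ⟨q, d, hd, hqd, hmono, hlim⟩ := exists_monotone_exp_tendsto φ hpos hlsc
  have hle : ∀ n t, Real.exp (q n t) ≤ F t := fun n t =>
    Monotone.ge_of_tendsto (fun m n h => Real.exp_le_exp.2 (hmono h t)) (hlim t) n
  have hFint : Integrable F torusMeasure := memLp_one_iff_integrable.1 (hbdd.mono_exponent le_top)
  have hIlim : Tendsto (fun n => ∫ t, Real.exp (q n t) ∂torusMeasure) atTop
      (𝓝 (∫ t, F t ∂torusMeasure)) := by
    refine tendsto_integral_of_dominated_convergence F
      (fun n => (q n).integrable_exp_torusMeasure.1) hFint (fun n => ae_of_all _ fun t => ?_)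
      (ae_of_all _ hlim)
    rw [Real.norm_of_nonneg (Real.exp_pos _).le]
    exact hle n t
  -- The increment of integrals after stage `n` is at most `4⁻ⁿ`; with an equal error allowance the
  -- step costs at most `2 · 4⁻ⁿ`, within the required `4 · 4⁻ⁿ`.
  obtain ⟨s, hs, hsI⟩ := extraction_forall_of_eventually
    (P := fun n k => ∫ t, F t ∂torusMeasure - ((1 / 2) ^ n) ^ 2
      < ∫ t, Real.exp (q k t) ∂torusMeasure)
    fun n => hIlim.eventually_const_lt (sub_lt_self _ (by positivity))
  have hbase := exists_hardyGE_norm_sq_eq_exp ha (q (s 0)) (hd _) (hqd _)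
  have hstep : ∀ (n : ℕ) (A : {A : Torus2 → ℂ // A ∈ hardyGE φ 0 ∧
      ∀ᵐ t ∂torusMeasure, ‖A t‖ ^ 2 = Real.exp (q (s n) t)}),
      ∃ B : {B : Torus2 → ℂ // B ∈ hardyGE φ 0 ∧
        ∀ᵐ t ∂torusMeasure, ‖B t‖ ^ 2 = Real.exp (q (s (n + 1)) t)},
        ∫ t, ‖B.1 t - A.1 t‖ ^ 2 ∂torusMeasure ≤ (2 * (1 / 2) ^ n) ^ 2 := by
    rintro n ⟨A, hA, hA'⟩
    obtain ⟨B, hB, hB', hAB⟩ := exists_hardyGE_raise ha hA (q (s n)) (q (s (n + 1))) hA'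
      (fun t => hmono (hs (Nat.lt_succ_self n)).le t) (add_nonneg (hd _) (hd _))
      (sub_mem_hardyGE_of_real (hd _) (hd _) (hqd (s n)) (hqd (s (n + 1))))
      (ε := ((1 / 2) ^ n) ^ 2) (by positivity)
    refine ⟨⟨B, hB, hB'⟩, hAB.trans ?_⟩
    have h1 : ∫ t, Real.exp (q (s (n + 1)) t) ∂torusMeasure ≤ ∫ t, F t ∂torusMeasure :=
      integral_mono (q (s (n + 1))).integrable_exp_torusMeasure hFint (hle _)
    have h2 := hsI n
    have h3 : (0 : ℝ) < ((1 / 2) ^ n) ^ 2 := by positivity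
    rw [mul_pow]
    linarith
  choose next hnext using hstep
  let A : ∀ n : ℕ, {A : Torus2 → ℂ // A ∈ hardyGE φ 0 ∧
      ∀ᵐ t ∂torusMeasure, ‖A t‖ ^ 2 = Real.exp (q (s n) t)} :=
    fun n => Nat.rec ⟨hbase.choose, hbase.choose_spec⟩ (fun n A => next n A) n
  have hbd : ∀ᵐ t ∂torusMeasure, F t ≤ (eLpNormEssSup F torusMeasure).toReal := by
    filter_upwards [ae_le_eLpNormEssSup (f := F) (μ := torusMeasure)] with t ht
    have hfin : eLpNormEssSup F torusMeasure ≠ ∞ := by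
      simpa using hbdd.eLpNorm_ne_top
    have := ENNReal.toReal_mono hfin ht
    rw [toReal_enorm] at this
    exact (le_abs_self _).trans this
  refine exists_hardyGE_limit (A := fun n => (A n).1)
    (C := (eLpNormEssSup F torusMeasure).toReal) (fun n => (A n).2.1) (fun n => (A n).2.2)
    (fun n => ?_) (fun t => (hlim t).comp hs.tendsto_atTop) fun n => hnext n (A n)
  filter_upwards [hbd] with t ht using (hle (s n) t).trans ht

end

theorem mainTheorem4 (f : Torus2 → ℝ) (hpos : ∀ t, 0 < f t)
    (hbdd : MemLp f ∞ torusMeasure) (hlsc : LowerSemicontinuous f)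
    (K : Set (Fin 2 → ℝ)) (hK : IsHalfCone K) :
    ∃ α ∈ hardySpace K, ∀ᵐ t ∂torusMeasure, (f t : ℂ) = α t * conj (α t) := by
  obtain ⟨φ, a, ha, hφK⟩ := hK.exists_functionals
  obtain ⟨α, hα, hα'⟩ := exists_hardyGE_norm_sq_eq ha hpos hbdd hlsc
  refine ⟨α, ⟨hα.1, fun k hk => hφK k (hα.2 k hk)⟩, ?_⟩
  filter_upwards [hα'] with t ht
  rw [Complex.mul_conj, Complex.normSq_eq_norm_sq, ht]
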